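/- Let $K$ be a totally real number field with ring of integers $O_K$ whose discriminant is a squarefree integer. Let $\mathrm{Aut}(O_K,\mathrm{tr}_{K/\mathbb{Q}})$ be the group, under composition, of all $\mathbb{Z}$-module automorphisms $\phi$ of $O_K$ such that $\mathrm{Tr}_{K/\mathbb{Q}}(\phi(x)\phi(y))=\mathrm{Tr}_{K/\mathbb{Q}}(xy)$ for all $x,y\in O_K$. Then $$\mathrm{Aut}(O_K,\mathrm{tr}_{K/\mathbb{Q}})=\pm\mathrm{Aut}(K),$$ that is, these automorphisms are exactly the maps $x\mapsto\sigma(x)$ and $x\mapsto-\sigma(x)$ on $O_K$ with $\sigma$ a field automorphism of $K$. Moreover, as a group, $$\mathrm{Aut}(O_K,\mathrm{tr}_{K/\mathbb{Q}})\cong\begin{cases}\mathbb{Z}/2\mathbb{Z}\times\mathbb{Z}/2\mathbb{Z} & \text{if } [K:\mathbb{Q}]=2,\\ \mathbb{Z}/2\mathbb{Z} & \text{otherwise.}\end{cases}$$ -/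

import Mathlib

open scoped NumberField

/-- The automorphism group of the lattice `(M, B)`, where `B` is a bilinear form on the
`R`-module `M`: the `R`-linear automorphisms of `M` which preserve `B`, under composition. -/
def bilinAut {R M : Type*} [CommRing R] [AddCommGroup M] [Module R M]
    (B : LinearMap.BilinForm R M) : Subgroup (M ≃ₗ[R] M) where
  carrier := {φ | ∀ x y : M, B (φ x) (φ y) = B x y}
  mul_mem' := fun {φ ψ} hφ hψ x y => (hφ (ψ x) (ψ y)).trans (hψ x y)
  one_mem' := fun _ _ => rfl
  inv_mem' := fun {φ} hφ x y => by
    have h := hφ (φ.symm x) (φ.symm y)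
    simp only [LinearEquiv.apply_symm_apply] at h
    exact h.symm

/-- The integral trace pairing `(x, y) ↦ Tr_{K/ℚ}(x * y)` on the ring of integers of `K`, with
values in `ℤ`; see `integralTraceForm_apply`. -/
noncomputable def integralTraceForm (K : Type*) [Field K] [NumberField K] :
    LinearMap.BilinForm ℤ (𝓞 K) :=
  Algebra.traceForm ℤ (𝓞 K)

theorem integralTraceForm_apply (K : Type*) [Field K] [NumberField K] (x y : 𝓞 K) :
    (integralTraceForm K x y : ℚ) = Algebra.trace ℚ K ((x : K) * (y : K)) := by
  rw [integralTraceForm, Algebra.traceForm_apply, Algebra.coe_trace_int]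
  simp

/-- The set `± Aut(K)` of maps `𝓞 K → 𝓞 K` of the form `x ↦ σ x` or `x ↦ - σ x`, where `σ` is a
field automorphism of `K` (automatically fixing `ℚ`). -/
def plusMinusAut (K : Type*) [Field K] [NumberField K] : Set (𝓞 K ≃ₗ[ℤ] 𝓞 K) :=
  {φ | ∃ σ : K ≃ₐ[ℚ] K,
    (∀ x : 𝓞 K, ((φ x : 𝓞 K) : K) = σ (x : K)) ∨ (∀ x : 𝓞 K, ((φ x : 𝓞 K) : K) = -σ (x : K))}

/-! Extend a trace isometry `φ` of the ring of integers to a `ℚ`-linear `Φ` on `K`, and write `σ ∘ Φ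
= ∑ m_{στ} τ` over the embeddings `τ`. `Φ` acts on the dual lattice modulo `𝓞 K`, a group of order
|discr K|. This order is squarefree, so the group is cyclic and `Φ` acts on it as an integer `c`.
Hence `m_{στ}` is `c δ_{στ}` plus an algebraic integer, so it is integral
(`isIntegral_embeddingMatrix`).

Since `Φ` is an isometry, the `m_{στ}²` sum to `n = [K : ℚ]` (`sum_sq_embeddingMatrix`). They are
real because `K` is totally real. Galois conjugation permutes the entries, so the product of the
nonzero squares is a positive integer. Every row is nonzero, so there are at least `n` nonzero
entries. The equality case of AM-GM then makes them exactly `n` entries `±1`, one in each row. Thus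
`σ ∘ Φ = ±τ`, and `±Φ` is multiplicative.

For the group structure, squarefreeness excludes proper intermediate fields, and a nontrivial
automorphism makes `K` Galois, hence equal to `ℚ(√discr K)`. -/

/-! ### Endomorphisms of a cyclic lattice quotient -/

/-- An endomorphism of a lattice `M` that preserves the sublattice `T N` acts on the quotient as an
integer, provided that the index of `T N` is squarefree. -/
theorem exists_int_forall_sub_smul_mem_range {ι M N : Type*} [Fintype ι] [DecidableEq ι]
    [AddCommGroup M] [AddCommGroup N] (bN : Module.Basis ι ℤ N) (bM : Module.Basis ι ℤ M)
    (T : N →ₗ[ℤ] M) (hT : Squarefree (LinearMap.toMatrix bN bM T).det)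
    (f : M →ₗ[ℤ] M) (hf : ∀ x, f (T x) ∈ LinearMap.range T) :
    ∃ c : ℤ, ∀ x, f x - c • x ∈ LinearMap.range T := by
  have : Module.Free ℤ M := .of_basis bM
  have : Module.Finite ℤ M := .of_basis bM
  -- Matching the bases turns `T` into an endomorphism of `M` with the same range and determinant,
  -- so that its index is read off the determinant.
  let e : M ≃ₗ[ℤ] N := bM.equiv bN (Equiv.refl ι)
  let T' : M →ₗ[ℤ] M := T ∘ₗ e.toLinearMap
  have hdet : LinearMap.det T' = (LinearMap.toMatrix bN bM T).det := by
    rw [← LinearMap.det_toMatrix bM]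
    congr 1
    ext i j
    simp [LinearMap.toMatrix_apply, T', e]
  have hrange : LinearMap.range T' = LinearMap.range T := by
    simp [T', LinearMap.range_comp]
  have hinj : Function.Injective T' := by
    rw [← LinearMap.ker_eq_bot]
    by_contra h
    exact hT.ne_zero (hdet ▸ LinearMap.det_eq_zero_iff_ker_ne_bot.mpr h)
  have hcard := Submodule.natAbs_det_equiv (LinearMap.range T') (LinearEquiv.ofInjective T' hinj)
  have hcard' : Nat.card (M ⧸ LinearMap.range T') = (LinearMap.det T').natAbs := by
    rw [← hcard]
    rfl
  rw [hrange, hdet] at hcard'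
  have hsq : Squarefree (Nat.card (M ⧸ LinearMap.range T)) := by
    rw [hcard']
    exact Int.squarefree_natAbs.mpr hT
  have hfin : Finite (M ⧸ LinearMap.range T) := Nat.finite_of_card_ne_zero hsq.ne_zero
  -- Squarefree order makes all Sylow subgroups cyclic; an abelian group with this property is
  -- cyclic, so its endomorphisms are power maps.
  have hZ : IsZGroup (Multiplicative (M ⧸ LinearMap.range T)) :=
    IsZGroup.of_squarefree hsq
  have hcyc : IsCyclic (Multiplicative (M ⧸ LinearMap.range T)) := inferInstance
  have hle : LinearMap.range T ≤ (LinearMap.range T).comap f := by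
    rintro _ ⟨x, rfl⟩
    exact hf x
  obtain ⟨c, hc⟩ := MonoidHom.map_cyclic
    (AddMonoidHom.toMultiplicative ((LinearMap.range T).mapQ _ f hle).toAddMonoidHom)
  refine ⟨c, fun x => ?_⟩
  have h : Submodule.mapQ _ _ f hle (Submodule.Quotient.mk x) =
      c • (Submodule.Quotient.mk x : M ⧸ LinearMap.range T) :=
    hc (Multiplicative.ofAdd (Submodule.Quotient.mk x))
  rw [Submodule.mapQ_apply, ← Submodule.Quotient.mk_smul] at h
  exact (Submodule.Quotient.eq _).mp h

/-! ### Extension to `K` and the dual lattice -/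

namespace NumberField

variable {K : Type*} [Field K] [NumberField K]

/-- The `ℚ`-linear extension to `K` of an additive endomorphism of the ring of integers. -/
noncomputable def extendIntegers (φ : 𝓞 K →ₗ[ℤ] 𝓞 K) : K →ₗ[ℚ] K :=
  (integralBasis K).constr ℚ fun i => ((φ (RingOfIntegers.basis K i) : 𝓞 K) : K)

theorem extendIntegers_coe (φ : 𝓞 K →ₗ[ℤ] 𝓞 K) (x : 𝓞 K) :
    extendIntegers φ (x : K) = φ x := by
  have h : ((extendIntegers φ).restrictScalars ℤ) ∘ₗ (Algebra.linearMap (𝓞 K) K).restrictScalars ℤ =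
      (Algebra.linearMap (𝓞 K) K).restrictScalars ℤ ∘ₗ φ := by
    refine (RingOfIntegers.basis K).ext fun i => ?_
    have := (integralBasis K).constr_basis ℚ
      (fun i => ((φ (RingOfIntegers.basis K i) : 𝓞 K) : K)) i
    rw [integralBasis_apply] at this
    exact this
  exact LinearMap.congr_fun h x

theorem trace_extendIntegers {φ : 𝓞 K ≃ₗ[ℤ] 𝓞 K} (hφ : φ ∈ bilinAut (integralTraceForm K))
    (x y : K) :
    Algebra.trace ℚ K (extendIntegers φ x * extendIntegers φ y) = Algebra.trace ℚ K (x * y) := by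
  have h : (Algebra.traceForm ℚ K).comp (extendIntegers φ) (extendIntegers φ) =
      Algebra.traceForm ℚ K := by
    refine LinearMap.BilinForm.ext_basis (integralBasis K) fun i j => ?_
    simp only [LinearMap.BilinForm.comp_apply, integralBasis_apply, Algebra.traceForm_apply]
    rw [extendIntegers_coe, extendIntegers_coe, ← integralTraceForm_apply,
      ← integralTraceForm_apply]
    exact congrArg _ (hφ _ _)
  exact LinearMap.congr_fun₂ h x y

/-- The basis of `K` dual to the integral basis. -/
noncomputable abbrev dualIntegralBasis (K : Type*) [Field K] [NumberField K] :
    Module.Basis (Module.Free.ChooseBasisIndex ℤ (𝓞 K)) ℚ K :=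
  (integralBasis K).traceDual

theorem trace_dualIntegralBasis_mul (k : Module.Free.ChooseBasisIndex ℤ (𝓞 K)) (x : 𝓞 K) :
    Algebra.trace ℚ K (dualIntegralBasis K k * x) = (RingOfIntegers.basis K).repr x k := by
  have h := (integralBasis K).traceDual.traceDual_repr_apply (x : K) k
  rw [Module.Basis.traceDual_traceDual, Algebra.traceForm_apply, mul_comm] at h
  rw [← h, integralBasis_repr_apply]
  simp

/-- The trace form embeds `𝓞 K` in its `ℤ`-dual with determinant the discriminant. The trace pairing
identifies this `ℤ`-dual with the dual lattice, and there `Φ` becomes precomposition with `φ⁻¹`. -/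
theorem exists_extendIntegers_dualIntegralBasis_eq (hK : Squarefree (discr K))
    {φ : 𝓞 K ≃ₗ[ℤ] 𝓞 K} (hφ : φ ∈ bilinAut (integralTraceForm K)) :
    ∃ c : ℤ, ∀ k, ∃ y : 𝓞 K,
      extendIntegers φ (dualIntegralBasis K k) = c • dualIntegralBasis K k + y := by
  classical
  set b := RingOfIntegers.basis K
  have hdet : Squarefree (LinearMap.toMatrix b b.dualBasis (integralTraceForm K)).det := by
    have : LinearMap.toMatrix b b.dualBasis (integralTraceForm K) = Algebra.traceMatrix ℤ b := by
      ext i j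
      simp [LinearMap.toMatrix_apply, Algebra.traceMatrix_apply, integralTraceForm, mul_comm]
    rw [this, ← Algebra.discr_def, discr_eq_discr]
    exact hK
  obtain ⟨c, hc⟩ := exists_int_forall_sub_smul_mem_range b b.dualBasis (integralTraceForm K) hdet
    φ.symm.toLinearMap.dualMap fun x => ⟨φ x, by
      ext z
      have := hφ x (φ.symm z)
      simpa using this⟩
  refine ⟨c, fun k => ?_⟩
  obtain ⟨y, hy⟩ := hc (b.coord k)
  refine ⟨y, ?_⟩
  have key : ∀ j, Algebra.trace ℚ K
      (extendIntegers φ (dualIntegralBasis K k) * integralBasis K j) =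
      Algebra.trace ℚ K ((c • dualIntegralBasis K k + y) * integralBasis K j) := by
    intro j
    have h1 : (integralBasis K j : K) = extendIntegers φ ((φ.symm (b j) : 𝓞 K) : K) := by
      rw [extendIntegers_coe, integralBasis_apply]
      simp [b]
    have h2 := congrArg (Int.cast : ℤ → ℚ) (LinearMap.congr_fun hy (b j))
    rw [integralTraceForm_apply] at h2
    conv_lhs => rw [h1, trace_extendIntegers hφ, trace_dualIntegralBasis_mul]
    rw [integralBasis_apply, add_mul, map_add, smul_mul_assoc, map_zsmul]
    change _ = c • Algebra.trace ℚ K (dualIntegralBasis K k * ((b j : 𝓞 K) : K)) +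
      Algebra.trace ℚ K ((y : K) * ((b j : 𝓞 K) : K))
    rw [h2, trace_dualIntegralBasis_mul]
    simp [b]
  refine (integralBasis K).traceDual.ext_elem fun j => ?_
  rw [Module.Basis.traceDual_repr_apply, Module.Basis.traceDual_repr_apply]
  exact key j

end NumberField

/-! ### Inequalities, counting and finite sums -/

/-- Equality case of the arithmetic-geometric mean inequality. -/
theorem eq_one_of_sum_le_card_of_one_le_prod {α : Type*} {s : Finset α} {v : α → ℝ}
    (hpos : ∀ i ∈ s, 0 < v i) (hsum : ∑ i ∈ s, v i ≤ s.card) (hprod : 1 ≤ ∏ i ∈ s, v i) :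
    ∀ i ∈ s, v i = 1 := by
  have hlog : 0 ≤ ∑ i ∈ s, Real.log (v i) := by
    rw [← Real.log_prod fun i hi => (hpos i hi).ne']
    exact Real.log_nonneg hprod
  -- These terms vanish only at `v i = 1`, and the hypotheses bound their sum above by zero.
  have hnonneg : ∀ i ∈ s, 0 ≤ v i - 1 - Real.log (v i) := fun i hi =>
    sub_nonneg.mpr (Real.log_le_sub_one_of_pos (hpos i hi))
  have hzero : ∑ i ∈ s, (v i - 1 - Real.log (v i)) = 0 := by
    refine le_antisymm ?_ (Finset.sum_nonneg hnonneg)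
    simp only [Finset.sum_sub_distrib, Finset.sum_const, nsmul_eq_mul, mul_one]
    linarith
  intro i hi
  by_contra h
  have := (Finset.sum_eq_zero_iff_of_nonneg hnonneg).mp hzero i hi
  linarith [Real.log_lt_sub_one_of_pos (hpos i hi) h]

/-- A relation whose graph has at most as many elements as its domain, and which relates every
element to something, is a function. -/
theorem Finset.eq_of_mem_of_mem_of_card_le {α β : Type*} [Fintype α]
    {s : Finset (α × β)} (hs : ∀ a, ∃ b, (a, b) ∈ s) (hcard : s.card ≤ Fintype.card α)
    {a : α} {b b' : β} (h : (a, b) ∈ s) (h' : (a, b') ∈ s) : b = b' := by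
  classical
  have himg : s.image Prod.fst = Finset.univ := by
    ext a
    simpa using hs a
  have hinj : Set.InjOn Prod.fst (s : Set (α × β)) := by
    refine Finset.card_image_iff.mp (le_antisymm Finset.card_image_le ?_)
    rwa [himg, Finset.card_univ]
  exact congrArg Prod.snd (hinj h h' rfl)

/-- When `s` and `t` run over embeddings, the inner sums on the right are traces. -/
theorem Finset.sum_sum_sq_sum_mul {ι κ R : Type*} [Fintype ι] [Fintype κ] [CommSemiring R]
    (a b : ι → κ → R) :
    ∑ s, ∑ t, (∑ k, a k s * b k t) ^ 2 =
      ∑ l, ∑ k, (∑ s, a k s * a l s) * ∑ t, b k t * b l t := by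
  have hl (s t : κ) : (∑ k, a k s * b k t) ^ 2 =
      ∑ q : ι × ι, a q.2 s * a q.1 s * (b q.2 t * b q.1 t) := by
    rw [sq, Finset.sum_mul_sum, Fintype.sum_prod_type]
    exact Finset.sum_congr rfl fun _ _ => Finset.sum_congr rfl fun _ _ => by ring
  have hr (k l : ι) : (∑ s, a k s * a l s) * ∑ t, b k t * b l t =
      ∑ p : κ × κ, a k p.1 * a l p.1 * (b k p.2 * b l p.2) := by
    rw [Finset.sum_mul_sum, Fintype.sum_prod_type]
  simp_rw [hl, hr]
  rw [← Fintype.sum_prod_type' (f := fun s t => ∑ q : ι × ι, a q.2 s * a q.1 s * (b q.2 t * b q.1 t)),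
    ← Fintype.sum_prod_type'
      (f := fun l k => ∑ p : κ × κ, a k p.1 * a l p.1 * (b k p.2 * b l p.2)),
    Finset.sum_comm]

/-! ### The matrix with respect to the embeddings -/

namespace NumberField

variable {K : Type*} [Field K] [NumberField K]

variable {Ω : Type*} [Field Ω] [Algebra ℚ Ω]

/-- The matrix of a linear endomorphism of `K` with respect to the family of all embeddings. -/
noncomputable def embeddingMatrix (Φ : K →ₗ[ℚ] K) (σ τ : K →ₐ[ℚ] Ω) : Ω :=
  ∑ k, σ (Φ (dualIntegralBasis K k)) * τ (integralBasis K k)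

theorem algEquiv_embeddingMatrix (Φ : K →ₗ[ℚ] K) (g : Ω ≃ₐ[ℚ] Ω) (σ τ : K →ₐ[ℚ] Ω) :
    g (embeddingMatrix Φ σ τ) =
      embeddingMatrix Φ (AlgEquiv.arrowCongr .refl g σ) (AlgEquiv.arrowCongr .refl g τ) := by
  simp [embeddingMatrix, map_sum]

variable [IsAlgClosed Ω]

/-- Expand `x` in the dual basis; its coordinates are traces, that is, sums over the embeddings. -/
theorem sum_embeddingMatrix_mul (Φ : K →ₗ[ℚ] K) (σ : K →ₐ[ℚ] Ω) (x : K) :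
    ∑ τ, embeddingMatrix Φ σ τ * τ x = σ (Φ x) := by
  have hx : x = ∑ k, Algebra.trace ℚ K (integralBasis K k * x) • dualIntegralBasis K k := by
    conv_lhs => rw [← (dualIntegralBasis K).sum_repr x]
    refine Finset.sum_congr rfl fun k _ => ?_
    rw [Module.Basis.traceDual_repr_apply, Algebra.traceForm_apply, mul_comm]
  simp only [embeddingMatrix, Finset.sum_mul]
  rw [Finset.sum_comm]
  conv_rhs => rw [hx]
  simp only [map_sum, map_smul Φ, map_smul σ]
  refine Finset.sum_congr rfl fun k _ => ?_
  rw [Algebra.smul_def (A := Ω), trace_eq_sum_embeddings Ω, Finset.sum_mul]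
  refine Finset.sum_congr rfl fun τ _ => ?_
  rw [map_mul]
  ring

/-- Dedekind's independence of characters makes the coefficients in the preceding expansion unique.
-/
theorem embeddingMatrix_id (σ τ : K →ₐ[ℚ] Ω) [Decidable (σ = τ)] :
    embeddingMatrix LinearMap.id σ τ = if σ = τ then 1 else 0 := by
  classical
  have hli : LinearIndependent Ω fun τ : K →ₐ[ℚ] Ω => (τ : K → Ω) :=
    (linearIndependent_monoidHom K Ω).comp (fun τ : K →ₐ[ℚ] Ω => (τ : K →* Ω))
      fun a b h => AlgHom.ext fun x => DFunLike.congr_fun h x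
  have h := Fintype.linearIndependent_iff.mp hli
    (fun τ => embeddingMatrix LinearMap.id σ τ - if σ = τ then 1 else 0) (by
      ext x
      have := sum_embeddingMatrix_mul LinearMap.id σ x
      simp [sub_mul, this]) τ
  rw [sub_eq_zero] at h
  convert h

/-- The sum is the trace of the product of the Gram matrices of `Φ` of the dual basis and of the
integral basis. The isometry removes `Φ`, and Gram matrices of dual bases are mutually inverse. -/
theorem sum_sq_embeddingMatrix {φ : 𝓞 K ≃ₗ[ℤ] 𝓞 K} (hφ : φ ∈ bilinAut (integralTraceForm K)) :
    ∑ p : (K →ₐ[ℚ] Ω) × (K →ₐ[ℚ] Ω), embeddingMatrix (extendIntegers φ) p.1 p.2 ^ 2 =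
      Module.finrank ℚ K := by
  set Φ := extendIntegers (φ : 𝓞 K →ₗ[ℤ] 𝓞 K)
  have h : ∑ p : (K →ₐ[ℚ] Ω) × (K →ₐ[ℚ] Ω), embeddingMatrix Φ p.1 p.2 ^ 2 =
      algebraMap ℚ Ω (∑ l, ∑ k, Algebra.trace ℚ K
        (dualIntegralBasis K k * dualIntegralBasis K l) *
          Algebra.trace ℚ K (integralBasis K k * integralBasis K l)) := by
    simp_rw [← trace_extendIntegers hφ (dualIntegralBasis K _), map_sum, map_mul,
      trace_eq_sum_embeddings Ω, map_mul, Fintype.sum_prod_type, embeddingMatrix]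
    exact Finset.sum_sum_sq_sum_mul _ _
  have hl (l) : ∑ k, Algebra.trace ℚ K (dualIntegralBasis K k * dualIntegralBasis K l) *
      Algebra.trace ℚ K (integralBasis K k * integralBasis K l) = 1 := by
    have h1 : dualIntegralBasis K l * integralBasis K l = ∑ k, Algebra.trace ℚ K
        (integralBasis K k * integralBasis K l) •
          (dualIntegralBasis K k * dualIntegralBasis K l) := by
      conv_lhs => rw [← (dualIntegralBasis K).sum_repr (integralBasis K l), Finset.mul_sum]
      refine Finset.sum_congr rfl fun k _ => ?_
      rw [Module.Basis.traceDual_repr_apply, Algebra.traceForm_apply, mul_smul_comm,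
        mul_comm (integralBasis K l), mul_comm (dualIntegralBasis K l)]
    have h2 := congrArg (Algebra.trace ℚ K) h1
    rw [Module.Basis.trace_traceDual_mul, if_pos rfl, map_sum] at h2
    rw [h2]
    exact Finset.sum_congr rfl fun k _ => by rw [map_smul, smul_eq_mul, mul_comm]
  rw [h, Finset.sum_congr rfl fun l _ => hl l]
  simp [RingOfIntegers.rank, ← Module.finrank_eq_card_chooseBasisIndex]

theorem isIntegral_embeddingMatrix (hK : Squarefree (discr K)) {φ : 𝓞 K ≃ₗ[ℤ] 𝓞 K}
    (hφ : φ ∈ bilinAut (integralTraceForm K)) (σ τ : K →ₐ[ℚ] Ω) :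
    IsIntegral ℤ (embeddingMatrix (extendIntegers φ) σ τ) := by
  classical
  obtain ⟨c, hc⟩ := exists_extendIntegers_dualIntegralBasis_eq hK hφ
  choose y hy using hc
  have h : embeddingMatrix (extendIntegers φ) σ τ = c • embeddingMatrix LinearMap.id σ τ +
      ∑ k, σ (y k) * τ (integralBasis K k) := by
    simp only [embeddingMatrix, hy, map_add, map_zsmul, add_mul, Finset.sum_add_distrib,
      Finset.smul_sum, smul_mul_assoc, LinearMap.id_apply]
  have hσ (σ : K →ₐ[ℚ] Ω) (z : 𝓞 K) : IsIntegral ℤ (σ z) :=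
    z.isIntegral_coe.map (σ.restrictScalars ℤ)
  rw [h, embeddingMatrix_id]
  refine IsIntegral.add (IsIntegral.smul c ?_) (IsIntegral.sum _ fun k _ => (hσ σ _).mul ?_)
  · split_ifs
    exacts [isIntegral_one, isIntegral_zero]
  · rw [integralBasis_apply]
    exact hσ τ _

/-- Automorphisms of `Ω` permute the nonzero entries, so the product is rational; being integral as
well, it lies in `ℤ`. -/
theorem exists_int_prod_embeddingMatrix [Algebra.IsAlgebraic ℚ Ω] {Φ : K →ₗ[ℚ] K}
    (hΦ : ∀ σ τ : K →ₐ[ℚ] Ω, IsIntegral ℤ (embeddingMatrix Φ σ τ))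
    [DecidablePred fun p : (K →ₐ[ℚ] Ω) × (K →ₐ[ℚ] Ω) => embeddingMatrix Φ p.1 p.2 ≠ 0] :
    ∃ m : ℤ, ∏ p : (K →ₐ[ℚ] Ω) × (K →ₐ[ℚ] Ω) with embeddingMatrix Φ p.1 p.2 ≠ 0,
      embeddingMatrix Φ p.1 p.2 ^ 2 = m := by
  set P := ∏ p : (K →ₐ[ℚ] Ω) × (K →ₐ[ℚ] Ω) with embeddingMatrix Φ p.1 p.2 ≠ 0,
    embeddingMatrix Φ p.1 p.2 ^ 2
  have hint : IsIntegral ℤ P :=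
    IsIntegral.prod _ fun p _ => (hΦ p.1 p.2).pow 2
  have hfix : ∀ g : Ω ≃ₐ[ℚ] Ω, g P = P := by
    intro g
    rw [map_prod]
    let e := AlgEquiv.arrowCongr (AlgEquiv.refl : K ≃ₐ[ℚ] K) g
    refine Finset.prod_equiv (e.prodCongr e) (fun p => ?_) fun p _ => ?_
    · simp only [Finset.mem_filter_univ, Equiv.prodCongr_apply, Prod.map, e]
      rw [← algEquiv_embeddingMatrix, map_ne_zero_iff g g.injective]
    · rw [map_pow, algEquiv_embeddingMatrix]
      rfl
  have : Normal ℚ Ω := normal_iff.mpr fun x =>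
    ⟨Algebra.IsIntegral.isIntegral x, IsAlgClosed.splits _⟩
  have : IsGalois ℚ Ω := {}
  obtain ⟨q, hq⟩ := (InfiniteGalois.mem_range_algebraMap_iff_fixed (k := ℚ) P).mpr hfix
  rw [← hq] at hint
  have hint' : IsIntegral ℤ q :=
    (isIntegral_algHom_iff ((Algebra.ofId ℚ Ω).restrictScalars ℤ) (algebraMap ℚ Ω).injective).mp hint
  obtain ⟨m, rfl⟩ := IsIntegrallyClosed.isIntegral_iff.mp hint'
  exact ⟨m, hq.symm.trans (by simp)⟩

theorem exists_eq_mul_of_mem_bilinAut [IsTotallyReal K] [Algebra.IsAlgebraic ℚ Ω]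
    (hK : Squarefree (discr K))
    {φ : 𝓞 K ≃ₗ[ℤ] 𝓞 K} (hφ : φ ∈ bilinAut (integralTraceForm K)) (σ : K →ₐ[ℚ] Ω) :
    ∃ (τ : K →ₐ[ℚ] Ω) (ε : ℤˣ), ∀ x : K, σ (extendIntegers φ x) = ε • τ x := by
  classical
  set Φ := extendIntegers (φ : 𝓞 K →ₗ[ℤ] 𝓞 K)
  let S : Finset ((K →ₐ[ℚ] Ω) × (K →ₐ[ℚ] Ω)) := {p | embeddingMatrix Φ p.1 p.2 ≠ 0}
  have hcardK : Fintype.card (K →ₐ[ℚ] Ω) = Module.finrank ℚ K := AlgHom.card ℚ K Ω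
  have hrow : ∀ σ, ∃ τ, (σ, τ) ∈ S := by
    intro σ
    by_contra! h
    simp only [S, Finset.mem_filter_univ, not_not] at h
    -- A zero row would give `σ 1 = 0`.
    have h1 := sum_embeddingMatrix_mul Φ σ ((φ.symm 1 : 𝓞 K) : K)
    rw [extendIntegers_coe] at h1
    simp [h] at h1
  have hcard : Module.finrank ℚ K ≤ S.card := by
    rw [← hcardK, ← Finset.card_univ]
    have : S.image Prod.fst = Finset.univ := by
      ext σ
      simpa using hrow σ
    rw [← this]
    exact Finset.card_image_le
  let j : Ω →ₐ[ℚ] ℂ := IsAlgClosed.lift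
  have hreal (σ τ) : ∃ r : ℝ, j (embeddingMatrix Φ σ τ) = r := by
    refine Complex.conj_eq_iff_real.mp ?_
    have h (σ : K →ₐ[ℚ] Ω) (x : K) : (starRingEnd ℂ) (j (σ x)) = j (σ x) :=
      RingHom.congr_fun (IsTotallyReal.complexEmbedding_isReal ((j : Ω →+* ℂ).comp σ)) x
    simp [embeddingMatrix, map_sum, h]
  choose r hr using hreal
  have hsum : ∑ p ∈ S, r p.1 p.2 ^ 2 = Module.finrank ℚ K := by
    have h := congrArg j (sum_sq_embeddingMatrix hφ)
    rw [← Finset.sum_filter_of_ne (p := fun p => embeddingMatrix Φ p.1 p.2 ≠ 0)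
      fun p _ hp h0 => hp (by rw [h0]; simp)] at h
    rw [map_sum, map_natCast, Finset.sum_congr rfl fun p _ =>
      (map_pow j _ 2).trans (congrArg (· ^ 2) (hr p.1 p.2))] at h
    exact_mod_cast h
  have hpos : ∀ p ∈ S, 0 < r p.1 p.2 ^ 2 := by
    intro p hp
    have : r p.1 p.2 ≠ 0 := by
      intro h0
      have h1 := hr p.1 p.2
      rw [h0, Complex.ofReal_zero, map_eq_zero] at h1
      exact (Finset.mem_filter_univ _).mp hp h1
    positivity
  have hprod : 1 ≤ ∏ p ∈ S, r p.1 p.2 ^ 2 := by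
    obtain ⟨m, hm⟩ := exists_int_prod_embeddingMatrix (isIntegral_embeddingMatrix (Ω := Ω) hK hφ)
    have h := congrArg j hm
    simp only [map_prod, map_pow, map_intCast] at h
    have h' : ∏ p ∈ S, r p.1 p.2 ^ 2 = (m : ℝ) := by
      have : ((∏ p ∈ S, r p.1 p.2 ^ 2 : ℝ) : ℂ) = ((m : ℝ) : ℂ) := by
        push_cast
        rw [← h]
        exact Finset.prod_congr rfl fun p _ => by rw [hr]
      exact_mod_cast this
    have h0 : (0 : ℝ) < m := h' ▸ Finset.prod_pos hpos
    rw [h']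
    exact_mod_cast h0
  have hone := eq_one_of_sum_le_card_of_one_le_prod hpos
    (by rw [hsum]; exact_mod_cast hcard) hprod
  -- With all squares equal to `1`, their sum `n` counts `S`; as every row meets `S`, each row has
  -- exactly one nonzero entry.
  have hcard' : S.card ≤ Fintype.card (K →ₐ[ℚ] Ω) := by
    rw [Finset.sum_congr rfl hone] at hsum
    simp only [Finset.sum_const, nsmul_eq_mul, mul_one] at hsum
    rw [hcardK]
    exact_mod_cast hsum.le
  obtain ⟨τ, hτ⟩ := hrow σ
  have hsq : embeddingMatrix Φ σ τ = 1 ∨ embeddingMatrix Φ σ τ = -1 := by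
    rw [← sq_eq_one_iff]
    refine (j : Ω →+* ℂ).injective ?_
    change j _ = j _
    have := hone _ hτ
    rw [map_pow, hr, map_one]
    exact_mod_cast this
  have hx (x : K) : σ (Φ x) = embeddingMatrix Φ σ τ * τ x := by
    rw [← sum_embeddingMatrix_mul]
    refine Finset.sum_eq_single τ (fun τ' _ hne => ?_) (by simp)
    by_contra h
    exact hne (Finset.eq_of_mem_of_mem_of_card_le hrow hcard'
      ((Finset.mem_filter_univ _).mpr (left_ne_zero_of_mul h)) hτ)
  rcases hsq with h | h
  · exact ⟨τ, 1, fun x => by rw [hx, h]; simp⟩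
  · exact ⟨τ, -1, fun x => by rw [hx, h]; simp⟩

end NumberField

/-! ### Comparison with `± Aut(K)` -/

namespace NumberField

variable {K : Type*} [Field K] [NumberField K]

theorem exists_algEquiv_of_mem_bilinAut [IsTotallyReal K] (hK : Squarefree (discr K))
    {φ : 𝓞 K ≃ₗ[ℤ] 𝓞 K} (hφ : φ ∈ bilinAut (integralTraceForm K)) :
    ∃ (ρ : K ≃ₐ[ℚ] K) (ε : ℤˣ), ∀ x : 𝓞 K, ((φ x : 𝓞 K) : K) = ε • ρ x := by
  let _ : Algebra ℚ (AlgebraicClosure ℚ) := AlgebraicClosure.instAlgebra ℚ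
  have : Algebra.IsAlgebraic ℚ (AlgebraicClosure ℚ) := AlgebraicClosure.isAlgebraic ℚ
  obtain ⟨τ, ε, h⟩ := exists_eq_mul_of_mem_bilinAut hK hφ
    (IsAlgClosed.lift : K →ₐ[ℚ] AlgebraicClosure ℚ)
  set σ := (IsAlgClosed.lift : K →ₐ[ℚ] AlgebraicClosure ℚ)
  set Φ := extendIntegers (φ : 𝓞 K →ₗ[ℤ] 𝓞 K)
  -- Since `σ` is injective, `ε • Φ` inherits multiplicativity from `τ`.
  have hε (x : K) : σ ((ε : ℤ) • Φ x) = τ x := by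
    rw [map_zsmul, h, Units.smul_def, smul_smul, ← Units.val_mul, Int.units_mul_self]
    simp
  have hinj : Function.Injective σ := σ.injective
  let f : K →ₐ[ℚ] K := AlgHom.ofLinearMap ((ε : ℤ) • Φ)
    (hinj (by rw [LinearMap.smul_apply, hε, map_one, map_one]))
    (fun x y => hinj (by simp only [LinearMap.smul_apply, map_mul, hε]))
  refine ⟨AlgEquiv.ofBijective f (Algebra.IsAlgebraic.algHom_bijective f), ε, fun x => ?_⟩
  rw [← LinearEquiv.coe_coe, ← extendIntegers_coe]
  change Φ x = (ε : ℤ) • (ε : ℤ) • Φ x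
  rw [smul_smul, ← Units.val_mul, Int.units_mul_self]
  simp

/-- The linear automorphism `x ↦ ε • ρ x` of the ring of integers. -/
noncomputable def signedAut (K : Type*) [Field K] [NumberField K] :
    (K ≃ₐ[ℚ] K) × ℤˣ →* (𝓞 K ≃ₗ[ℤ] 𝓞 K) where
  toFun p :=
    ((RingOfIntegers.mapRingEquiv p.1).toAddEquiv.toIntLinearEquiv).trans
      (DistribMulAction.toLinearEquiv ℤ (𝓞 K) p.2)
  map_one' := by
    ext x
    simp
  map_mul' p q := by
    ext x
    simp [Units.smul_def, mul_assoc]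

theorem signedAut_apply (p : (K ≃ₐ[ℚ] K) × ℤˣ) (x : 𝓞 K) :
    ((signedAut K p x : 𝓞 K) : K) = p.2 • p.1 x := by
  simp [signedAut, Units.smul_def]

theorem signedAut_mem (p : (K ≃ₐ[ℚ] K) × ℤˣ) :
    signedAut K p ∈ bilinAut (integralTraceForm K) := by
  intro x y
  rw [← Int.cast_inj (α := ℚ), integralTraceForm_apply, integralTraceForm_apply, signedAut_apply,
    signedAut_apply, Units.smul_def, Units.smul_def, smul_mul_smul_comm, ← Units.val_mul,
    Int.units_mul_self, Units.val_one, one_smul, ← map_mul, Algebra.trace_eq_of_algEquiv]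

theorem signedAut_injective : Function.Injective (signedAut K) := by
  intro p q h
  have h' (x : 𝓞 K) : p.2 • p.1 x = q.2 • q.1 x := by
    rw [← signedAut_apply, ← signedAut_apply, h]
  have h2 : p.2 = q.2 := by
    have := h' 1
    simp only [map_one, Units.smul_def, zsmul_eq_mul, mul_one] at this
    exact Units.ext (Int.cast_injective this)
  refine Prod.ext (AlgEquiv.ext fun x => ?_) h2
  refine DFunLike.congr_fun (IsFractionRing.injective_comp_algebraMap (A := 𝓞 K) (K := K) (L := K)
    (a₁ := (p.1 : K →+* K)) (a₂ := (q.1 : K →+* K)) ?_) x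
  ext x
  have := h' x
  rw [h2] at this
  exact smul_left_cancel _ this

theorem mem_bilinAut_iff [IsTotallyReal K] (hK : Squarefree (discr K)) (φ : 𝓞 K ≃ₗ[ℤ] 𝓞 K) :
    φ ∈ bilinAut (integralTraceForm K) ↔ ∃ p, signedAut K p = φ := by
  refine ⟨fun h => ?_, ?_⟩
  · obtain ⟨ρ, ε, h⟩ := exists_algEquiv_of_mem_bilinAut hK h
    refine ⟨(ρ, ε), LinearEquiv.ext fun x => RingOfIntegers.ext ?_⟩
    rw [h, signedAut_apply]
  · rintro ⟨p, rfl⟩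
    exact signedAut_mem p

theorem mem_plusMinusAut_iff (φ : 𝓞 K ≃ₗ[ℤ] 𝓞 K) :
    φ ∈ plusMinusAut K ↔ ∃ p, signedAut K p = φ := by
  constructor
  · rintro ⟨σ, h | h⟩
    · refine ⟨(σ, 1), LinearEquiv.ext fun x => RingOfIntegers.ext ?_⟩
      rw [h, signedAut_apply, one_smul]
    · refine ⟨(σ, -1), LinearEquiv.ext fun x => RingOfIntegers.ext ?_⟩
      rw [h, signedAut_apply]
      simp
  · rintro ⟨⟨σ, ε⟩, rfl⟩
    refine ⟨σ, ?_⟩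
    simp only [signedAut_apply]
    rcases Int.units_eq_one_or ε with rfl | rfl
    · exact .inl fun x => one_smul _ _
    · exact .inr fun x => by simp

/-- A totally real field of squarefree discriminant has only the trace form automorphisms coming
from `± Aut(K)`. -/
noncomputable def bilinAutMulEquiv [IsTotallyReal K] (hK : Squarefree (discr K)) :
    (K ≃ₐ[ℚ] K) × ℤˣ ≃* bilinAut (integralTraceForm K) :=
  MulEquiv.ofBijective ((signedAut K).codRestrict _ signedAut_mem)
    ⟨fun _ _ h => signedAut_injective (congrArg Subtype.val h), fun φ =>
      ((mem_bilinAut_iff hK φ.1).mp φ.2).imp fun _ h => Subtype.ext h⟩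

/-! ### Automorphisms of a field of squarefree discriminant -/

/-- In the tower formula `d_F ^ [K : F]` divides `d_K`, so `[K : F] ≥ 2` forces `|d_F| = 1`, against
the bound `|d_F| > 2` for `F ≠ ℚ`. -/
theorem finrank_eq_one_of_squarefree_discr (hK : Squarefree (discr K)) (F : IntermediateField ℚ K)
    (hF : 1 < Module.finrank F K) : Module.finrank ℚ F = 1 := by
  by_contra h
  have h1 : 1 < Module.finrank ℚ F := by
    have : 0 < Module.finrank ℚ F := Module.finrank_pos
    omega
  have h2 := abs_discr_gt_two h1
  have h3 := natAbs_discr_eq_absNorm_differentIdeal_mul_natAbs_discr_pow F (𝓞 F) K (𝓞 K)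
  have h4 : (discr F).natAbs * (discr F).natAbs ∣ (discr K).natAbs := by
    rw [h3, ← sq]
    exact Dvd.dvd.mul_left (pow_dvd_pow _ hF) _
  have h5 := Nat.isUnit_iff.mp (Int.squarefree_natAbs.mpr hK _ h4)
  rw [Int.abs_eq_natAbs, h5] at h2
  norm_num at h2

theorem fixedField_eq_bot_of_squarefree_discr (hK : Squarefree (discr K))
    (H : Subgroup (K ≃ₐ[ℚ] K)) (hH : H ≠ ⊥) : IntermediateField.fixedField H = ⊥ := by
  rw [← IntermediateField.finrank_eq_one_iff]
  refine finrank_eq_one_of_squarefree_discr hK _ ?_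
  rw [IntermediateField.finrank_fixedField_eq_card]
  exact H.one_lt_card_iff_ne_bot.mpr hH

/-- The root is the determinant of the conjugates of the integral basis, which lie in `K` because
`K` is Galois. -/
theorem exists_sq_eq_discr [IsGalois ℚ K] : ∃ δ : K, δ ^ 2 = discr K := by
  classical
  have hcard : Fintype.card (Module.Free.ChooseBasisIndex ℤ (𝓞 K)) = Fintype.card (K ≃ₐ[ℚ] K) := by
    rw [← Nat.card_eq_fintype_card (α := K ≃ₐ[ℚ] K), IsGalois.card_aut_eq_finrank,
      ← Module.finrank_eq_card_chooseBasisIndex, RingOfIntegers.rank]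
  let e := Fintype.equivOfCardEq hcard
  let A : Matrix _ _ K := Matrix.of fun i j => e j (integralBasis K i)
  have hA : (Algebra.traceMatrix ℚ (integralBasis K)).map (algebraMap ℚ K) = A * A.transpose := by
    ext i j
    simp only [Matrix.map_apply, Algebra.traceMatrix_apply, Algebra.traceForm_apply,
      trace_eq_sum_automorphisms, Matrix.mul_apply, Matrix.transpose_apply, A, Matrix.of_apply]
    rw [← e.sum_comp]
    simp only [map_mul]
  refine ⟨A.det, ?_⟩
  have h := congrArg Matrix.det hA
  rw [Matrix.det_mul, Matrix.det_transpose, ← sq, ← RingHom.mapMatrix_apply, ← RingHom.map_det,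
    ← Algebra.discr_def, ← coe_discr] at h
  rw [← h]
  simp

/-- The fixed field of the full automorphism group is `ℚ`, so `K` is Galois and contains `δ = √d_K`.
This `δ` is irrational, so `ℚ(δ)` is not the fixed field of a nontrivial subgroup and must be `K`.
-/
theorem finrank_eq_two_of_exists_algEquiv_ne_one (hK : Squarefree (discr K))
    {σ : K ≃ₐ[ℚ] K} (hσ : σ ≠ 1) : Module.finrank ℚ K = 2 := by
  have hgal : IsGalois ℚ K := IsGalois.of_fixedField_eq_bot ℚ K
    (fixedField_eq_bot_of_squarefree_discr hK ⊤ fun h => hσ (Subgroup.mem_bot.mp (h ▸ trivial)))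
  have hn : 1 < Module.finrank ℚ K := by
    rw [← IsGalois.card_aut_eq_finrank, Finite.one_lt_card_iff_nontrivial]
    exact ⟨σ, 1, hσ⟩
  obtain ⟨δ, hδ⟩ := exists_sq_eq_discr (K := K)
  have hbot : δ ∉ (⊥ : IntermediateField ℚ K) := by
    intro h
    obtain ⟨q, rfl⟩ := IntermediateField.mem_bot.mp h
    have hq : q ^ 2 = (discr K : ℚ) := (algebraMap ℚ K).injective (by simpa using hδ)
    have hint : IsIntegral ℤ q := by
      refine IsIntegral.of_pow two_pos ?_
      rw [hq]
      exact isIntegral_algebraMap (R := ℤ) (x := discr K)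
    obtain ⟨m, rfl⟩ := IsIntegrallyClosed.isIntegral_iff.mp hint
    have hm : m ^ 2 = discr K := by
      rw [← Int.cast_inj (α := ℚ), ← hq]
      simp
    -- A squarefree perfect square is `1`, which contradicts `|d_K| > 2`.
    have hu := Int.isUnit_iff.mp (hK m ⟨1, by rw [← hm]; ring⟩)
    have h2 := abs_discr_gt_two hn
    rw [← hm] at h2
    rcases hu with rfl | rfl <;> norm_num at h2
  have hfix : IntermediateField.fixedField (IntermediateField.adjoin ℚ {δ}).fixingSubgroup =
      IntermediateField.adjoin ℚ {δ} := IsGalois.fixedField_fixingSubgroup _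
  have htop : (IntermediateField.adjoin ℚ {δ}).fixingSubgroup = ⊥ := by
    by_contra h
    rw [fixedField_eq_bot_of_squarefree_discr hK _ h] at hfix
    exact hbot (hfix ▸ IntermediateField.mem_adjoin_simple_self ℚ δ)
  rw [htop, IntermediateField.fixedField_bot] at hfix
  have hdeg : Module.finrank ℚ K ≤ 2 := by
    rw [← IntermediateField.finrank_top', hfix,
      IntermediateField.adjoin.finrank (Algebra.IsIntegral.isIntegral δ)]
    have hp : (Polynomial.X ^ 2 - Polynomial.C (discr K : ℚ)).natDegree = 2 :=
      Polynomial.natDegree_X_pow_sub_C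
    rw [← hp]
    refine Polynomial.natDegree_le_of_dvd (minpoly.dvd _ _ (by simp [hδ])) ?_
    exact Polynomial.X_pow_sub_C_ne_zero two_pos _
  omega

end NumberField

open NumberField in
theorem theorem4p4 (K : Type*) [Field K] [NumberField K] [NumberField.IsTotallyReal K]
    (hK : Squarefree (NumberField.discr K)) :
    (bilinAut (integralTraceForm K) : Set (𝓞 K ≃ₗ[ℤ] 𝓞 K)) = plusMinusAut K ∧
    (Module.finrank ℚ K = 2 →
      Nonempty (bilinAut (integralTraceForm K) ≃*
        Multiplicative (ZMod 2) × Multiplicative (ZMod 2))) ∧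
    (Module.finrank ℚ K ≠ 2 →
      Nonempty (bilinAut (integralTraceForm K) ≃* Multiplicative (ZMod 2))) := by
  have hcard : Nat.card (Multiplicative (ZMod 2)) = 2 := Nat.card_zmod 2
  have : Fact (Nat.Prime 2) := ⟨Nat.prime_two⟩
  have hunits : Nat.card ℤˣ = 2 := by simp
  let e : ℤˣ ≃* Multiplicative (ZMod 2) := mulEquivOfPrimeCardEq hunits hcard
  refine ⟨Set.ext fun φ => (mem_bilinAut_iff hK φ).trans (mem_plusMinusAut_iff φ).symm,
    fun h => ?_, fun h => ?_⟩
  · have : Algebra.IsQuadraticExtension ℚ K := ⟨h⟩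
    have hgal : Nat.card (K ≃ₐ[ℚ] K) = 2 := (IsGalois.card_aut_eq_finrank ℚ K).trans h
    exact ⟨(bilinAutMulEquiv hK).symm.trans
      ((mulEquivOfPrimeCardEq hgal hcard).prodCongr e)⟩
  · have : Unique (K ≃ₐ[ℚ] K) := ⟨⟨1⟩, fun σ => by
      by_contra hσ
      exact h (finrank_eq_two_of_exists_algEquiv_ne_one hK hσ)⟩
    exact ⟨(bilinAutMulEquiv hK).symm.trans (MulEquiv.uniqueProd.trans e)⟩
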